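/- Let $q$ be a power of an odd prime $p$ and $n\ge 1$. Regard $\mathrm{Sp}(2n,q)$ as the group of matrices acting on the right on row vectors $(x,y)\in V=GF(q)^{n}\oplus GF(q)^{n}$ and preserving the symplectic form $\varphi((x_1,y_1),(x_2,y_2))=x_1y_2^{T}-y_1x_2^{T}$. Let $\psi(\alpha)=e^{(2\pi i/p)\mathrm{tr}_{GF(q)/GF(p)}(\alpha)}$ be the canonical additive character of $GF(q)$, and let $\omega$ be the Weil character of $\mathrm{Sp}(2n,q)$, that is, the character of the Weil representation $W$ on the functions $GF(q)^n\to\mathbb{C}$. Here $W$ satisfies $W(g)^{-1}U(v)W(g)=U(vg)$ for all $v\in V$ and $g\in\mathrm{Sp}(2n,q)$, where $(U(x,y)f)(t)=\psi(-2\,t x^{T}-x y^{T})f(t+y)$, so that $U(u)U(v)=\psi(\varphi(u,v))U(u+v)$; the scalars are normalized so that for every $g$ the determinants of $W(g)$ on the even functions and on the odd functions are equal. For a symmetric $n\times n$ matrix $Q$ over $GF(q)$ put $g_Q=\begin{bmatrix} I&0\\ Q&I\end{bmatrix}\in \mathrm{Sp}(2n,q)$, let $B=\{g_Q : Q \text{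 symmetric}\}$ and $G=\langle -I\rangle\times B$. A subgroup $H$ of $\mathrm{Sp}(2n,q)$ is called Weil-free if every irreducible constituent of $\omega|H$ appears with multiplicity $1$. Then: 1. Every Weil-free subgroup $H$ of $G$ satisfies $|H|\ge 2q^n$, and there is a Weil-free subgroup of $G$ of order exactly $2q^n$. 2. Explicitly, identify $GF(q)^n$ with $GF(q^n)$ by means of any $GF(q)$-basis $\zeta_1,\dots,\zeta_n$ of $GF(q^n)$, let $\mathrm{tr}:GF(q^n)\to GF(q)$ be the trace, and for $\alpha\in GF(q^n)$ let $Q_\alpha=[\mathrm{tr}(\alpha\zeta_i\zeta_j)]_{i,j}$ be the symmetric matrix of the quadratic form $Q_\alpha(\zeta)=\mathrm{tr}(\alpha\zeta^2)$. Then $\{g_{Q_\alpha} : \alpha\in GF(q^n)\}$ is a subgroup of $B$ meeting $\langle -I\rangle$ trivially, and $H=\langle -I\rangle\times\{g_{Q_\alpha} : \alpha\in GF(q^n)\}$ is a Weil-free subgroup of $G$ of order $2q^n$. -/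

import Mathlib

open Matrix

namespace SymplecticWeil

section Construction

variable {F : Type*} [Field F] {n : ℕ}

/-- The symplectic form `φ((x₁,y₁),(x₂,y₂)) = x₁ y₂ᵀ - y₁ x₂ᵀ` on `F²ⁿ`. -/
def form (u v : Fin n ⊕ Fin n → F) : F :=
  (u ∘ Sum.inl) ⬝ᵥ (v ∘ Sum.inr) - (u ∘ Sum.inr) ⬝ᵥ (v ∘ Sum.inl)

theorem form_eq (u v : Fin n ⊕ Fin n → F) : form u v = - (u ⬝ᵥ (J (Fin n) F *ᵥ v)) := by
  simp [form, J, dotProduct, Matrix.mulVec, Fintype.sum_sum_type, Matrix.one_apply]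
  ring

theorem form_vecMul (g : symplecticGroup (Fin n) F) (u v : Fin n ⊕ Fin n → F) :
    form (u ᵥ* g.1) (v ᵥ* g.1) = form u v := by
  rw [form_eq, form_eq, ← Matrix.dotProduct_mulVec, ← Matrix.mulVec_transpose,
    Matrix.mulVec_mulVec, Matrix.mulVec_mulVec, SymplecticGroup.mem_iff.1 g.2]

theorem form_add_left (u v w : Fin n ⊕ Fin n → F) : form (u + v) w = form u w + form v w := by
  simp only [form_eq, add_dotProduct]; ring

theorem form_add_right (u v w : Fin n ⊕ Fin n → F) : form u (v + w) = form u v + form u w := by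
  simp only [form_eq, Matrix.mulVec_add, dotProduct_add]; ring

theorem form_neg_left (u v : Fin n ⊕ Fin n → F) : form (-u) v = -form u v := by
  simp only [form_eq, neg_dotProduct]

theorem form_neg_right (u v : Fin n ⊕ Fin n → F) : form u (-v) = -form u v := by
  simp only [form_eq, Matrix.mulVec_neg, dotProduct_neg]

theorem form_swap (u v : Fin n ⊕ Fin n → F) : form u v = -form v u := by
  rw [form, form, dotProduct_comm (v ∘ Sum.inl), dotProduct_comm (v ∘ Sum.inr)]; ring

theorem form_self (u : Fin n ⊕ Fin n → F) : form u u = 0 := by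
  rw [form, dotProduct_comm, sub_self]

/-- The parity operator `(P f)(t) = f(-t)`. -/
def parity : Module.End ℂ ((Fin n → F) → ℂ) := LinearMap.funLeft ℂ ℂ (fun t => -t)

/-- The projection onto the even functions along the odd functions. -/
noncomputable def evenProj : Module.End ℂ ((Fin n → F) → ℂ) := (1 / 2 : ℂ) • (1 + parity)

/-- The projection onto the odd functions along the even functions. -/
noncomputable def oddProj : Module.End ℂ ((Fin n → F) → ℂ) := (1 / 2 : ℂ) • (1 - parity)

theorem parity_mul_self : (parity : Module.End ℂ ((Fin n → F) → ℂ)) * parity = 1 := by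
  ext1 f
  funext t
  simp [parity]

theorem evenProj_add_oddProj : (evenProj + oddProj : Module.End ℂ ((Fin n → F) → ℂ)) = 1 := by
  rw [evenProj, oddProj, ← smul_add, add_add_sub_cancel, ← two_smul ℂ (1 : Module.End ℂ _),
    smul_smul]
  norm_num

theorem evenProj_mul_self :
    (evenProj * evenProj : Module.End ℂ ((Fin n → F) → ℂ)) = evenProj := by
  rw [evenProj, smul_mul_smul_comm, mul_add, add_mul, add_mul, parity_mul_self, one_mul, mul_one,
    one_mul, add_comm parity 1, ← two_smul ℂ, smul_smul]
  norm_num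

theorem oddProj_mul_self : (oddProj * oddProj : Module.End ℂ ((Fin n → F) → ℂ)) = oddProj := by
  have h : (oddProj : Module.End ℂ ((Fin n → F) → ℂ)) = 1 - evenProj :=
    eq_sub_of_add_eq' evenProj_add_oddProj
  rw [h, mul_sub, sub_mul, sub_mul, evenProj_mul_self]; simp

theorem evenProj_mul_oddProj : (evenProj * oddProj : Module.End ℂ ((Fin n → F) → ℂ)) = 0 := by
  have h : (oddProj : Module.End ℂ ((Fin n → F) → ℂ)) = 1 - evenProj :=
    eq_sub_of_add_eq' evenProj_add_oddProj
  rw [h, mul_sub, evenProj_mul_self]; simp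

theorem oddProj_mul_evenProj : (oddProj * evenProj : Module.End ℂ ((Fin n → F) → ℂ)) = 0 := by
  have h : (oddProj : Module.End ℂ ((Fin n → F) → ℂ)) = 1 - evenProj :=
    eq_sub_of_add_eq' evenProj_add_oddProj
  rw [h, sub_mul, evenProj_mul_self]; simp

theorem parity_comm_proj {T : Module.End ℂ ((Fin n → F) → ℂ)} (h : parity * T = T * parity) :
    evenProj * T = T * evenProj ∧ oddProj * T = T * oddProj := by
  simp only [evenProj, oddProj, smul_mul_assoc, mul_smul_comm, add_mul, sub_mul, mul_add, mul_sub,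
    h, one_mul, mul_one, and_self]

theorem even_mul {T S : Module.End ℂ ((Fin n → F) → ℂ)} (h : parity * S = S * parity) :
    (T * S) * evenProj + oddProj = (T * evenProj + oddProj) * (S * evenProj + oddProj) := by
  obtain ⟨h1, h2⟩ := parity_comm_proj h
  have e1 : T * evenProj * (S * evenProj) = T * S * evenProj := by
    rw [mul_assoc, ← mul_assoc evenProj, h1, mul_assoc S, evenProj_mul_self, mul_assoc]
  have e2 : T * evenProj * oddProj = 0 := by rw [mul_assoc, evenProj_mul_oddProj, mul_zero]
  have e3 : oddProj * (S * evenProj) = 0 := by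
    rw [← mul_assoc, h2, mul_assoc, oddProj_mul_evenProj, mul_zero]
  rw [mul_add, add_mul, add_mul, e1, e2, e3, oddProj_mul_self, zero_add, add_zero]

theorem odd_mul {T S : Module.End ℂ ((Fin n → F) → ℂ)} (h : parity * S = S * parity) :
    evenProj + (T * S) * oddProj = (evenProj + T * oddProj) * (evenProj + S * oddProj) := by
  obtain ⟨h1, h2⟩ := parity_comm_proj h
  have e1 : T * oddProj * (S * oddProj) = T * S * oddProj := by
    rw [mul_assoc, ← mul_assoc oddProj, h2, mul_assoc S, oddProj_mul_self, mul_assoc]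
  have e2 : T * oddProj * evenProj = 0 := by rw [mul_assoc, oddProj_mul_evenProj, mul_zero]
  have e3 : evenProj * (S * oddProj) = 0 := by
    rw [← mul_assoc, h1, mul_assoc, evenProj_mul_oddProj, mul_zero]
  rw [mul_add, add_mul, add_mul, e1, e2, e3, evenProj_mul_self, zero_add, add_zero]

variable [Finite F]

variable (F) in
/-- The canonical additive character `α ↦ exp ((2πi/p) tr α)` of a finite field `F` of
characteristic `p`, where `tr` is the trace from `F` to its prime field. -/
noncomputable def canonicalChar : AddChar F ℂ :=
  letI := ZMod.algebra F (ringChar F)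
  have : NeZero (ringChar F) := ⟨CharP.ringChar_ne_zero_of_finite F⟩
  (ZMod.stdAddChar (N := ringChar F)).compAddMonoidHom
    (Algebra.trace (ZMod (ringChar F)) F).toAddMonoidHom

theorem eq_zero_of_canonicalChar {c : F} (h : ∀ x, canonicalChar F (c * x) = 1) : c = 0 := by
  have : NeZero (ringChar F) := ⟨CharP.ringChar_ne_zero_of_finite F⟩
  have : Fact (ringChar F).Prime := ⟨CharP.char_is_prime F _⟩
  let := ZMod.algebra F (ringChar F)
  by_contra hc
  obtain ⟨a, ha⟩ := FiniteField.trace_to_zmod_nondegenerate F hc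
  apply ha
  have := h a
  rw [← (ZMod.stdAddChar (N := ringChar F)).map_zero_eq_one] at this
  exact ZMod.injective_stdAddChar this

/-- The Weyl (Schrödinger) operators on the space of functions `Fⁿ → ℂ`:
for `v = (x,y)`, `(U(v) f)(t) = ψ(-(2 t xᵀ + x yᵀ)) f(t + y)`. -/
noncomputable def weylOp (v : Fin n ⊕ Fin n → F) : Module.End ℂ ((Fin n → F) → ℂ) where
  toFun f t := canonicalChar F
    (-(2 * (t ⬝ᵥ (v ∘ Sum.inl)) + (v ∘ Sum.inl) ⬝ᵥ (v ∘ Sum.inr))) * f (t + v ∘ Sum.inr)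
  map_add' f g := by ext t; simp [mul_add]
  map_smul' c f := by ext t; simp; ring

theorem weylOp_apply (v : Fin n ⊕ Fin n → F) (f : (Fin n → F) → ℂ) (t : Fin n → F) :
    weylOp v f t = canonicalChar F
      (-(2 * (t ⬝ᵥ (v ∘ Sum.inl)) + (v ∘ Sum.inl) ⬝ᵥ (v ∘ Sum.inr))) * f (t + v ∘ Sum.inr) := rfl

theorem weylOp_mul (u v : Fin n ⊕ Fin n → F) :
    weylOp u * weylOp v = canonicalChar F (form u v) • weylOp (u + v) := by
  ext1 f
  funext t
  have e1 : (u + v) ∘ Sum.inl = u ∘ Sum.inl + v ∘ Sum.inl := rfl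
  have e2 : (u + v) ∘ Sum.inr = u ∘ Sum.inr + v ∘ Sum.inr := rfl
  simp only [Module.End.mul_apply, LinearMap.smul_apply, Pi.smul_apply, smul_eq_mul, weylOp_apply,
    ← mul_assoc, ← AddChar.map_add_eq_mul, e1, e2, form, add_assoc]
  congr 2
  simp only [dotProduct_add, add_dotProduct]
  rw [dotProduct_comm (v ∘ Sum.inl) (u ∘ Sum.inr)]
  ring

theorem weylOp_zero : weylOp (0 : Fin n ⊕ Fin n → F) = 1 := by
  ext1 f
  funext t
  have e1 : (0 : Fin n ⊕ Fin n → F) ∘ Sum.inl = 0 := rfl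
  have e2 : (0 : Fin n ⊕ Fin n → F) ∘ Sum.inr = 0 := rfl
  simp [weylOp_apply, e1, e2]

/-- `T` is the operator of the Weil representation at the symplectic matrix `g`:
it is invertible, it satisfies `T⁻¹ U(v) T = U(v g)` for all `v`, which determines it up to a
nonzero scalar (and forces it to preserve the spaces of even and of odd functions), and the scalar
is fixed by asking that its determinants on even and on odd functions agree. -/
structure IsWeilOperator (g : symplecticGroup (Fin n) F)
    (T : Module.End ℂ ((Fin n → F) → ℂ)) : Prop where
  isUnit : IsUnit T
  intertwines : ∀ v, weylOp v * T = T * weylOp (v ᵥ* g.1)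
  det_eq : LinearMap.det (T * evenProj + oddProj) = LinearMap.det (evenProj + T * oddProj)


theorem scalar_of_commute (hq : ringChar F ≠ 2) (T : Module.End ℂ ((Fin n → F) → ℂ))
    (h : ∀ v, weylOp v * T = T * weylOp v) : ∃ c : ℂ, T = c • 1 := by
  classical
  have h2 : (2 : F) ≠ 0 := Ring.two_ne_zero hq
  have hd : ∀ (s t : Fin n → F), t ≠ s → T (Pi.single s 1) t = 0 := by
    intro s t hts
    by_contra hne
    apply hts
    funext i
    have key : ∀ c : F, canonicalChar F ((2 * (s i - t i)) * c) = 1 := by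
      intro c
      have h1 := congrFun (LinearMap.congr_fun (h (Sum.elim (Pi.single i c) 0)) (Pi.single s 1)) t
      have h3 : weylOp (Sum.elim (Pi.single i c) 0) (Pi.single s (1 : ℂ))
          = canonicalChar F (-(2 * (s i * c))) • Pi.single s (1 : ℂ) := by
        funext r
        rw [weylOp_apply, Sum.elim_comp_inl, Sum.elim_comp_inr]
        by_cases hr : r = s
        · subst hr; simp
        · simp [hr]
      rw [Module.End.mul_apply, Module.End.mul_apply, h3, map_smul, weylOp_apply] at h1
      simp only [Sum.elim_comp_inl, Sum.elim_comp_inr, dotProduct_zero, add_zero,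
        dotProduct_single, Pi.smul_apply, smul_eq_mul] at h1
      have h4 := mul_right_cancel₀ hne h1
      have : (2 * (s i - t i)) * c = -(2 * (t i * c)) - -(2 * (s i * c)) := by ring
      rw [this, AddChar.map_sub_eq_div, h4, div_self]
      exact (AddChar.val_isUnit _ _).ne_zero
    have := eq_zero_of_canonicalChar key
    exact (sub_eq_zero.1 ((mul_eq_zero.1 this).resolve_left h2)).symm
  have ht : ∀ s : Fin n → F, T (Pi.single s 1) s = T (Pi.single 0 1) 0 := by
    intro s
    have h1 := congrFun (LinearMap.congr_fun (h (Sum.elim 0 s)) (Pi.single s 1)) 0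
    have h3 : weylOp (Sum.elim 0 s) (Pi.single s (1 : ℂ)) = Pi.single 0 (1 : ℂ) := by
      funext r
      rw [weylOp_apply]
      by_cases hr : r = 0
      · subst hr; simp
      · simp [hr]
    rw [Module.End.mul_apply, Module.End.mul_apply, h3, weylOp_apply] at h1
    simpa using h1
  refine ⟨T (Pi.single 0 1) 0, ?_⟩
  have := Fintype.ofFinite F
  refine (Pi.basisFun ℂ (Fin n → F)).ext fun s => ?_
  funext t
  by_cases hts : t = s
  · subst hts; simp [ht t]
  · simp [hd s t hts, hts]

/-- The average of `U(w) X U(-w g)` over `w`, an intertwiner for `g`. -/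
noncomputable def avg [Fintype F] (g : symplecticGroup (Fin n) F)
    (X : Module.End ℂ ((Fin n → F) → ℂ)) : Module.End ℂ ((Fin n → F) → ℂ) :=
  ∑ w : Fin n ⊕ Fin n → F, weylOp w * X * weylOp (-(w ᵥ* g.1))

theorem avg_intertwines [Fintype F] (g : symplecticGroup (Fin n) F)
    (X : Module.End ℂ ((Fin n → F) → ℂ)) (v : Fin n ⊕ Fin n → F) :
    weylOp v * avg g X = avg g X * weylOp (v ᵥ* g.1) := by
  rw [avg, Finset.mul_sum, Finset.sum_mul]
  refine Fintype.sum_equiv (Equiv.addLeft v) _ _ fun w => ?_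
  have h1 : weylOp v * (weylOp w * X * weylOp (-(w ᵥ* g.1)))
      = canonicalChar F (form v w) • (weylOp (v + w) * X * weylOp (-(w ᵥ* g.1))) := by
    rw [← mul_assoc, ← mul_assoc, weylOp_mul, smul_mul_assoc, smul_mul_assoc]
  have h2 : weylOp (-((v + w) ᵥ* g.1)) * weylOp (v ᵥ* g.1)
      = canonicalChar F (form v w) • weylOp (-(w ᵥ* g.1)) := by
    rw [weylOp_mul, ← Matrix.neg_vecMul, form_vecMul]
    congr 2
    · rw [form_neg_left, form_add_left, form_self, zero_add, form_swap, neg_neg]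
    · rw [Matrix.neg_vecMul, Matrix.add_vecMul]; abel
  simp only [Equiv.coe_addLeft]
  rw [h1, mul_assoc _ _ (weylOp (v ᵥ* g.1)), h2, mul_smul_comm]

theorem weylOp_mul_neg (w : Fin n ⊕ Fin n → F) : weylOp w * weylOp (-w) = 1 := by
  have : form w (-w) = 0 := by rw [form_neg_right, form_self, neg_zero]
  rw [weylOp_mul, this, add_neg_cancel, weylOp_zero]
  simp

theorem isUnit_of_intertwines (hq : ringChar F ≠ 2) (g : symplecticGroup (Fin n) F)
    (T : Module.End ℂ ((Fin n → F) → ℂ)) (hT : T ≠ 0)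
    (h : ∀ v, weylOp v * T = T * weylOp (v ᵥ* g.1)) : IsUnit T := by
  classical
  have := Fintype.ofFinite F
  -- some `Y T` has nonzero trace
  obtain ⟨Y, hY⟩ : ∃ Y, LinearMap.trace ℂ ((Fin n → F) → ℂ) (Y * T) ≠ 0 := by
    obtain ⟨f, hf⟩ : ∃ f, T f ≠ 0 := by
      by_contra! hc
      exact hT (LinearMap.ext hc)
    obtain ⟨t, ht⟩ := Function.ne_iff.1 hf
    refine ⟨((LinearMap.proj t : ((Fin n → F) → ℂ) →ₗ[ℂ] ℂ).smulRight f), ?_⟩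
    rw [LinearMap.trace_mul_comm, Module.End.mul_eq_comp, 
      show T ∘ₗ ((LinearMap.proj t : ((Fin n → F) → ℂ) →ₗ[ℂ] ℂ).smulRight f)
        = (LinearMap.proj t : ((Fin n → F) → ℂ) →ₗ[ℂ] ℂ).smulRight (T f) from
        LinearMap.ext fun x => by simp, LinearMap.trace_smulRight]
    exact ht
  obtain ⟨c, hc⟩ := scalar_of_commute hq (avg (1 : symplecticGroup (Fin n) F) (Y * T)) (by
    intro v
    simpa using avg_intertwines (1 : symplecticGroup (Fin n) F) (Y * T) v)
  have hc0 : c ≠ 0 := by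
    rintro rfl
    rw [zero_smul] at hc
    have h1 := congrArg (LinearMap.trace ℂ ((Fin n → F) → ℂ)) hc
    rw [avg, map_sum, map_zero] at h1
    have h2 : ∀ w : Fin n ⊕ Fin n → F, LinearMap.trace ℂ ((Fin n → F) → ℂ)
        (weylOp w * (Y * T) * weylOp (-(w ᵥ* (1 : symplecticGroup (Fin n) F).1)))
        = LinearMap.trace ℂ ((Fin n → F) → ℂ) (Y * T) := by
      intro w
      have hw := weylOp_mul_neg (-w)
      rw [neg_neg] at hw
      rw [LinearMap.trace_mul_comm, ← mul_assoc]
      simp [hw]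
    rw [Finset.sum_congr rfl fun w _ => h2 w, Finset.sum_const, nsmul_eq_mul] at h1
    exact hY ((mul_eq_zero.1 h1).resolve_left (by simp))
  have hfac : avg (1 : symplecticGroup (Fin n) F) (Y * T) = avg g⁻¹ Y * T := by
    rw [avg, avg, Finset.sum_mul]
    refine Finset.sum_congr rfl fun w _ => ?_
    have h3 := h (-(w ᵥ* (g⁻¹).1))
    have h4 : (-(w ᵥ* (g⁻¹).1)) ᵥ* g.1 = -(w ᵥ* (1 : symplecticGroup (Fin n) F).1) := by
      rw [Matrix.neg_vecMul, Matrix.vecMul_vecMul, ← Submonoid.coe_mul, inv_mul_cancel]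
    rw [h4] at h3
    rw [mul_assoc _ _ T, h3]
    simp only [mul_assoc]
  have hl : (c⁻¹ • avg g⁻¹ Y) * T = 1 := by
    rw [smul_mul_assoc, ← hfac, hc, smul_smul, inv_mul_cancel₀ hc0, one_smul]
  exact IsUnit.of_mul_eq_one_right _ hl

theorem exists_intertwiner (hq : ringChar F ≠ 2) (g : symplecticGroup (Fin n) F) :
    ∃ T : Module.End ℂ ((Fin n → F) → ℂ), IsUnit T ∧
      ∀ v, weylOp v * T = T * weylOp (v ᵥ* g.1) := by
  classical
  have := Fintype.ofFinite F
  have h2 : (2 : F) ≠ 0 := Ring.two_ne_zero hq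
  obtain ⟨X, hX⟩ : ∃ X, avg g X ≠ 0 := by
    by_contra! hall
    have h1 : ∑ u : Fin n ⊕ Fin n → F, weylOp u * avg g (weylOp (-u)) = 0 := by simp [hall]
    have h3 : ∀ u w : Fin n ⊕ Fin n → F, weylOp u * (weylOp w * weylOp (-u) * weylOp (-(w ᵥ* g.1)))
        = canonicalChar F (2 * form u w) • (weylOp w * weylOp (-(w ᵥ* g.1))) := by
      intro u w
      rw [← mul_assoc, ← mul_assoc, weylOp_mul, smul_mul_assoc, weylOp_mul, smul_smul,
        ← AddChar.map_add_eq_mul, smul_mul_assoc]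
      congr 2
      · rw [form_add_left, form_neg_right, form_neg_right, form_self, form_swap w u]; ring
      · congr 1; abel
    simp only [avg, Finset.mul_sum, h3] at h1
    rw [Finset.sum_comm] at h1
    simp only [← Finset.sum_smul] at h1
    have h4 : ∀ w : Fin n ⊕ Fin n → F, w ≠ 0 →
        ∑ u : Fin n ⊕ Fin n → F, canonicalChar F (2 * form u w) = 0 := by
      intro w hw
      let L : (Fin n ⊕ Fin n → F) →+ F :=
        { toFun := fun u => 2 * form u w
          map_zero' := by simp [form_eq]
          map_add' := fun a b => by simp [form_eq, add_dotProduct]; ring }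
      have := AddChar.sum_eq_zero_of_ne_one (ψ := (canonicalChar F).compAddMonoidHom L) ?_
      · simpa [L] using this
      · intro h5
        apply hw
        have h6 : ∀ u, canonicalChar F (2 * form u w) = 1 := fun u => by
          simpa [L] using DFunLike.congr_fun h5 u
        have h7 : J (Fin n) F *ᵥ w = 0 := by
          funext i
          have : -(2 * (J (Fin n) F *ᵥ w) i) = 0 := eq_zero_of_canonicalChar fun x => by
            have := h6 (Pi.single i x)
            rw [form_eq, single_dotProduct] at this
            rw [← this]; congr 1; ring
          simpa [h2] using this
        have h8 := congrArg (fun z => J (Fin n) F *ᵥ z) h7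
        simpa [Matrix.mulVec_mulVec, J_squared, Matrix.neg_mulVec] using h8
    rw [Finset.sum_eq_single 0 (fun w _ hw => by rw [h4 w hw, zero_smul]) (by simp)] at h1
    simp [form_eq, weylOp_zero] at h1
  exact ⟨avg g X, isUnit_of_intertwines hq g _ hX (avg_intertwines g X), avg_intertwines g X⟩


theorem scalar_of_intertwines (hq : ringChar F ≠ 2) (g : symplecticGroup (Fin n) F)
    {T S : Module.End ℂ ((Fin n → F) → ℂ)} (hT : IsUnit T)
    (h : ∀ v, weylOp v * T = T * weylOp (v ᵥ* g.1))
    (h' : ∀ v, weylOp v * S = S * weylOp (v ᵥ* g.1)) : ∃ c : ℂ, S = c • T := by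
  obtain ⟨R, rfl⟩ := hT
  obtain ⟨c, hc⟩ := scalar_of_commute hq (S * R⁻¹.1) (by
    intro v
    have h1 : weylOp (v ᵥ* g.1) * R⁻¹.1 = R⁻¹.1 * weylOp v := by
      rw [Units.eq_inv_mul_iff_mul_eq, ← mul_assoc, Units.mul_inv_eq_iff_eq_mul, h]
    rw [← mul_assoc, h', mul_assoc, h1, mul_assoc])
  refine ⟨c, ?_⟩
  rw [Units.mul_inv_eq_iff_eq_mul] at hc
  rw [hc, smul_mul_assoc, one_mul]

theorem parity_weylOp (v : Fin n ⊕ Fin n → F) : parity * weylOp v = weylOp (-v) * parity := by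
  ext1 f
  funext t
  have e1 : (-v) ∘ Sum.inl = -(v ∘ Sum.inl) := rfl
  have e2 : (-v) ∘ Sum.inr = -(v ∘ Sum.inr) := rfl
  simp [parity, weylOp_apply, LinearMap.funLeft_apply, e1, e2]
  exact Or.inl (congrArg f (by abel))

theorem trace_parity (hq : ringChar F ≠ 2) :
    LinearMap.trace ℂ ((Fin n → F) → ℂ) parity = 1 := by
  classical
  have := Fintype.ofFinite F
  have h2 : (2 : F) ≠ 0 := Ring.two_ne_zero hq
  rw [LinearMap.trace_eq_matrix_trace ℂ (Pi.basisFun ℂ (Fin n → F)), Matrix.trace]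
  rw [Finset.sum_eq_single 0]
  · simp [parity, LinearMap.funLeft_apply]
  · intro t _ ht
    have : -t ≠ t := fun h => ht (by
      funext i
      have := congrFun h i
      simp only [Pi.neg_apply] at this
      have h3 : 2 * t i = 0 := by linear_combination -this
      simpa [h2] using h3)
    simp [parity, LinearMap.funLeft_apply, this]
  · simp

theorem parity_comm (hq : ringChar F ≠ 2) (g : symplecticGroup (Fin n) F)
    {T : Module.End ℂ ((Fin n → F) → ℂ)} (hT : IsUnit T)
    (h : ∀ v, weylOp v * T = T * weylOp (v ᵥ* g.1)) : parity * T = T * parity := by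
  obtain ⟨c, hc⟩ := scalar_of_intertwines hq g (S := parity * T * parity) hT h (by
    intro v
    have h1 := parity_weylOp (-v)
    rw [neg_neg] at h1
    rw [← mul_assoc, ← mul_assoc, ← h1, mul_assoc parity, h, mul_assoc, mul_assoc, mul_assoc,
      mul_assoc, parity_weylOp, Matrix.neg_vecMul])
  have h1 : parity * T = c • (T * parity) := by
    have := congrArg (· * parity) hc
    simpa [mul_assoc, parity_mul_self] using this
  have hP : (parity : Module.End ℂ ((Fin n → F) → ℂ))  = c • (T * parity * hT.unit⁻¹.1) := by
    have : hT.unit.1 = T := rfl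
    rw [← smul_mul_assoc, ← h1, Units.eq_mul_inv_iff_mul_eq, this]
  have h3 := congrArg (LinearMap.trace ℂ ((Fin n → F) → ℂ)) hP
  rw [map_smul, LinearMap.trace_mul_comm, ← mul_assoc, IsUnit.val_inv_mul, one_mul,
    trace_parity hq, smul_eq_mul, mul_one] at h3
  rw [h1, ← h3, one_smul]

theorem det_of_isProj {E : Type*} [AddCommGroup E] [Module ℂ E] [FiniteDimensional ℂ E]
    {p q : Module.End ℂ E} (hp : p * p = p) (hpq : p + q = 1) (c : ℂ) :
    ∃ d : ℕ, (d : ℂ) = LinearMap.trace ℂ E p ∧ LinearMap.det (c • p + q) = c ^ d := by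
  have h : LinearMap.IsProj (LinearMap.range p) p :=
    LinearMap.IsIdempotentElem.isProj_range p hp
  refine ⟨_, h.trace.symm, ?_⟩
  have hq : q = 1 - p := eq_sub_of_add_eq' hpq
  let e := Submodule.prodEquivOfIsCompl _ _ h.isCompl
  have h1 : c • p + q = e.conj (LinearMap.prodMap (c • LinearMap.id) LinearMap.id) := by
    have h2 : p = e.conj (LinearMap.prodMap LinearMap.id 0) := h.eq_conj_prodMap
    have h3 : (1 : Module.End ℂ E) = e.conj (LinearMap.prodMap LinearMap.id LinearMap.id) := by
      rw [LinearMap.prodMap_id, LinearEquiv.conj_id]; rfl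
    have h4 : c • p + q = c • e.conj (LinearMap.prodMap LinearMap.id 0)
        + (e.conj (LinearMap.prodMap LinearMap.id LinearMap.id)
          - e.conj (LinearMap.prodMap LinearMap.id 0)) := by rw [← h2, ← h3, hq]
    rw [h4, ← map_smul, ← map_sub, ← map_add]
    congr 1
    ext <;> simp
  rw [h1, LinearEquiv.conj_apply, LinearMap.comp_assoc]
  refine (LinearMap.det_conj _ e).trans ?_
  rw [LinearMap.det_prodMap, LinearMap.det_smul, LinearMap.det_id]
  simp

theorem det_scalar (hq : ringChar F ≠ 2) (c : ℂ) :
    LinearMap.det ((c • 1 : Module.End ℂ ((Fin n → F) → ℂ)) * evenProj + oddProj) =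
      c * LinearMap.det (evenProj + (c • 1 : Module.End ℂ ((Fin n → F) → ℂ)) * oddProj) := by
  have := Fintype.ofFinite F
  obtain ⟨a, ha, ha'⟩ := det_of_isProj (evenProj_mul_self (F := F) (n := n)) evenProj_add_oddProj c
  obtain ⟨b, hb, hb'⟩ := det_of_isProj (oddProj_mul_self (F := F) (n := n))
    ((add_comm _ _).trans evenProj_add_oddProj) c
  have hab : a = b + 1 := by
    have : (a : ℂ) = b + 1 := by
      rw [ha, hb, evenProj, oddProj, map_smul, map_smul, map_add, map_sub, trace_parity hq,
        smul_eq_mul, smul_eq_mul]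
      ring
    exact_mod_cast this
  rw [smul_one_mul, smul_one_mul, add_comm evenProj, ha', hb', hab, pow_succ']

theorem existsUnique_isWeilOperator (hq : ringChar F ≠ 2) (g : symplecticGroup (Fin n) F) :
    ∃! T, IsWeilOperator g T := by
  obtain ⟨T, hT, hi⟩ := exists_intertwiner hq g
  have hc := parity_comm hq g hT hi
  have hscale : ∀ c : ℂ, LinearMap.det ((c • T) * evenProj + oddProj)
      = c * LinearMap.det (evenProj + (c • 1 : Module.End ℂ ((Fin n → F) → ℂ)) * oddProj)
        * LinearMap.det (T * evenProj + oddProj) := by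
    intro c
    rw [← smul_one_mul c T, even_mul hc, map_mul, det_scalar hq]
  have hscale' : ∀ c : ℂ, LinearMap.det (evenProj + (c • T) * oddProj)
      = LinearMap.det (evenProj + (c • 1 : Module.End ℂ ((Fin n → F) → ℂ)) * oddProj)
        * LinearMap.det (evenProj + T * oddProj) := by
    intro c
    rw [← smul_one_mul c T, odd_mul hc, map_mul]
  have hone : ((1 : Module.End ℂ ((Fin n → F) → ℂ))) * evenProj + oddProj = 1 ∧
      evenProj + (1 : Module.End ℂ ((Fin n → F) → ℂ)) * oddProj = 1 := by
    simp [evenProj_add_oddProj]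
  have hunit : ∀ S : Module.End ℂ ((Fin n → F) → ℂ), IsUnit S → parity * S = S * parity →
      LinearMap.det (S * evenProj + oddProj) ≠ 0 ∧ LinearMap.det (evenProj + S * oddProj) ≠ 0 := by
    rintro _ ⟨S, rfl⟩ hS
    have h1 := congrArg LinearMap.det (even_mul (T := S⁻¹.1) hS)
    have h2 := congrArg LinearMap.det (odd_mul (T := S⁻¹.1) hS)
    rw [Units.inv_mul, map_mul] at h1 h2
    rw [hone.1, map_one] at h1
    rw [hone.2, map_one] at h2
    exact ⟨right_ne_zero_of_mul (h1 ▸ one_ne_zero), right_ne_zero_of_mul (h2 ▸ one_ne_zero)⟩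
  obtain ⟨ha, hb⟩ := hunit T hT hc
  have hcs : ∀ c : ℂ, c ≠ 0 → LinearMap.det
      (evenProj + (c • 1 : Module.End ℂ ((Fin n → F) → ℂ)) * oddProj) ≠ 0 := by
    intro c h0
    refine (hunit (c • 1) ?_ ?_).2
    · exact (isUnit_one (M := Module.End ℂ ((Fin n → F) → ℂ))).smul (Units.mk0 c h0)
    · simp
  refine ⟨(LinearMap.det (evenProj + T * oddProj) / LinearMap.det (T * evenProj + oddProj)) • T,
    ⟨?_, ?_, ?_⟩, ?_⟩
  · exact hT.smul (Units.mk0 _ (div_ne_zero hb ha))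
  · intro v
    rw [mul_smul_comm, hi, smul_mul_assoc]
  · rw [hscale, hscale']
    field_simp
  · rintro S ⟨hS, hS', hS''⟩
    obtain ⟨c, rfl⟩ := scalar_of_intertwines hq g hT hi hS'
    have h0 : c ≠ 0 := by
      rintro rfl
      rw [zero_smul] at hS
      exact hS.ne_zero rfl
    congr 1
    rw [hscale, hscale'] at hS''
    have := hcs c h0
    field_simp
    apply mul_left_cancel₀ this
    linear_combination hS''

theorem isWeilOperator_one : IsWeilOperator (1 : symplecticGroup (Fin n) F) 1 :=
  ⟨isUnit_one, by simp, by simp⟩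

theorem IsWeilOperator.mul (hq : ringChar F ≠ 2) {g h : symplecticGroup (Fin n) F}
    {T S : Module.End ℂ ((Fin n → F) → ℂ)} (hT : IsWeilOperator g T) (hS : IsWeilOperator h S) :
    IsWeilOperator (g * h) (T * S) where
  isUnit := hT.isUnit.mul hS.isUnit
  intertwines v := by
    rw [← mul_assoc, hT.intertwines, mul_assoc, hS.intertwines, ← mul_assoc,
      Matrix.vecMul_vecMul, Submonoid.coe_mul]
  det_eq := by
    have := parity_comm hq h hS.isUnit hS.intertwines
    rw [even_mul this, odd_mul this, map_mul, map_mul, hT.det_eq, hS.det_eq]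

/-- The Weil representation of `Sp(2n, F)`, `F` a finite field of odd order, on functions on `Fⁿ`,
attached to the canonical additive character of `F`. Its character is the Weil character. -/
noncomputable def weilRep (hq : ringChar F ≠ 2) (n : ℕ) :
    Representation ℂ (symplecticGroup (Fin n) F) ((Fin n → F) → ℂ) where
  toFun g := (existsUnique_isWeilOperator hq g).choose
  map_one' := ((existsUnique_isWeilOperator hq 1).unique
    (existsUnique_isWeilOperator hq 1).choose_spec.1 isWeilOperator_one)
  map_mul' g h := ((existsUnique_isWeilOperator hq (g * h)).unique
    (existsUnique_isWeilOperator hq (g * h)).choose_spec.1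
    ((existsUnique_isWeilOperator hq g).choose_spec.1.mul hq
      (existsUnique_isWeilOperator hq h).choose_spec.1))

theorem isWeilOperator_weilRep (hq : ringChar F ≠ 2) (g : symplecticGroup (Fin n) F) :
    IsWeilOperator g (weilRep hq n g) :=
  (existsUnique_isWeilOperator hq g).choose_spec.1


/-- `H` is Weil-free: every irreducible representation `σ` of `H` occurs with multiplicity
`dim Hom_H(σ, ω|H) ≤ 1` in the restriction to `H` of the Weil representation. (As `H` is finite, all
its irreducible representations are realised on the spaces `ℂᵈ`, so `Type` is large enough.) -/
def WeilFree (hq : ringChar F ≠ 2) (H : Subgroup (symplecticGroup (Fin n) F)) : Prop :=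
  ∀ (V : Type) [AddCommGroup V] [Module ℂ V] (σ : Representation ℂ H V), σ.IsIrreducible →
    Module.finrank ℂ (Representation.IntertwiningMap σ ((weilRep hq n).comp H.subtype)) ≤ 1

end Construction
section Subgroups

variable {F : Type*} [Field F] {n : ℕ}

variable (F n) in
/-- The element `-I` of `Sp(2n, F)`. -/
def negI : symplecticGroup (Fin n) F := ⟨-1, SymplecticGroup.neg_mem (one_mem _)⟩

/-- For a symmetric matrix `Q`, the symplectic matrix `g_Q = [I 0; Q I]`. -/
def gMat (Q : Matrix (Fin n) (Fin n) F) (hQ : Q.IsSymm) : symplecticGroup (Fin n) F :=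
  ⟨Matrix.fromBlocks 1 0 Q 1, SymplecticGroup.fromBlocks_mem_iff.2 (by simp [hQ.eq])⟩

theorem gMat_mul (Q R : Matrix (Fin n) (Fin n) F) (hQ : Q.IsSymm) (hR : R.IsSymm) :
    gMat Q hQ * gMat R hR = gMat (Q + R) (hQ.add hR) :=
  Subtype.ext (by simp [gMat, Matrix.fromBlocks_multiply])

theorem gMat_zero : gMat (0 : Matrix (Fin n) (Fin n) F) Matrix.isSymm_zero = 1 :=
  Subtype.ext (by simp [gMat])

variable (F n) in
/-- The subgroup `B = {g_Q : Q symmetric}` of `Sp(2n, F)`. -/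
def subgroupB : Subgroup (symplecticGroup (Fin n) F) where
  carrier := {g | ∃ Q, ∃ hQ : Q.IsSymm, g = gMat Q hQ}
  one_mem' := ⟨0, Matrix.isSymm_zero, gMat_zero.symm⟩
  mul_mem' := by
    rintro _ _ ⟨Q, hQ, rfl⟩ ⟨R, hR, rfl⟩
    exact ⟨Q + R, hQ.add hR, gMat_mul Q R hQ hR⟩
  inv_mem' := by
    rintro _ ⟨Q, hQ, rfl⟩
    refine ⟨-Q, hQ.neg, inv_eq_of_mul_eq_one_right ?_⟩
    rw [gMat_mul, ← gMat_zero]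
    congr 1
    exact add_neg_cancel Q

variable (F n) in
/-- The subgroup `G = ⟨-I⟩ × B` of `Sp(2n, F)`. -/
def subgroupG : Subgroup (symplecticGroup (Fin n) F) := Subgroup.zpowers (negI F n) ⊔ subgroupB F n

variable {K : Type*} [Field K] [Algebra F K]

/-- The symmetric matrix of the quadratic form `Q_α(ζ) = tr(α ζ²)` on `K`, and of its bilinear form
`(ξ, η) ↦ tr(α ξ η)`, with respect to a basis `b` of `K` over `F`. -/
noncomputable def traceMatrix (b : Module.Basis (Fin n) F K) (α : K) : Matrix (Fin n) (Fin n) F :=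
  Matrix.of fun i j => Algebra.trace F K (α * b i * b j)

theorem traceMatrix_isSymm (b : Module.Basis (Fin n) F K) (α : K) : (traceMatrix b α).IsSymm := by
  ext i j
  simp only [traceMatrix, Matrix.transpose_apply, Matrix.of_apply]
  rw [mul_right_comm]

/-- If `v` is the coordinate vector of `ζ`, then `v Q vᵀ = tr(α ζ²)`. -/
theorem traceMatrix_quadratic (b : Module.Basis (Fin n) F K) (α ζ : K) :
    (b.repr ζ : Fin n → F) ⬝ᵥ (traceMatrix b α *ᵥ (b.repr ζ : Fin n → F))
      = Algebra.trace F K (α * ζ ^ 2) := by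
  have h : α * ζ ^ 2 = ∑ i, ∑ j, (b.repr ζ i * b.repr ζ j) • (α * b i * b j) := by
    conv_lhs => rw [sq, ← b.sum_repr ζ, Finset.sum_mul_sum, Finset.mul_sum]
    refine Finset.sum_congr rfl fun i _ => ?_
    rw [Finset.mul_sum]
    refine Finset.sum_congr rfl fun j _ => ?_
    simp only [Algebra.smul_def, map_mul]
    ring
  rw [h]
  simp only [map_sum, map_smul, smul_eq_mul, dotProduct, Matrix.mulVec, traceMatrix,
    Matrix.of_apply, Finset.mul_sum]
  refine Finset.sum_congr rfl fun i _ => Finset.sum_congr rfl fun j _ => ?_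
  ring

end Subgroups

end SymplecticWeil

/-! By Schur's lemma `W(g)` is determined up to a nonzero scalar by its intertwining relation. So
`W(g_Q)` is a scalar times multiplication by `ψ(-t Q tᵀ)` (`weilRep_of_mem_subgroupB`), and `W(-I)`
is a scalar times the parity operator (`weilRep_negI`). These scalars never matter, since only
common eigenvectors are compared.

Lower bound. The delta functions at `t` and `-t` are eigenvectors of `B` with the same character,
because a quadratic form is even. A Weil-free `H ≤ G` is therefore not contained in `B`. It then
contains some `-g_Q`, whose `p`-th power is `-I`, so `H = ⟨-I⟩ × (H ∩ B)`. The even vectors `δ_t +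
δ_{-t}` are eigenvectors of `H`, so multiplicity one forces the characters `g_Q ↦ ψ(-t Q tᵀ)` of `H
∩ B` to separate the pairs `±t`. A finite group has at most as many linear characters as elements,
whence `q^n ≤ 2 |H ∩ B|` (`WeilFree.card_pow_le`). Both `q^n` and `|H ∩ B|` are powers of the odd
prime `p`, so the factor 2 can be dropped, and `|H| = 2 |H ∩ B| ≥ 2 q^n`.

Construction. If `ψ(-t Q_α tᵀ)` agrees at `s` and `t` for all `α`, nondegeneracy of the trace form
shows that the corresponding elements of `GF(q^n)` have equal squares, so `s = ±t`
(`eq_or_eq_neg_of_quadExp_eq`). Hence a common eigenvector of `⟨-I⟩ × {g_{Q_α}}` is supported on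
some `{t, -t}`. The eigenvalue of parity fixes the ratio of its two values, so each joint eigenspace
is at most a line; as the group is abelian, this is multiplicity one. -/

namespace SymplecticWeil

/-! ### Multiplicity one in terms of common eigenvectors -/

section Multiplicity

variable {H V W : Type*} [Group H] [AddCommGroup V] [Module ℂ V] [AddCommGroup W] [Module ℂ W]

/-- A common eigenvector of a representation carries a one-dimensional subrepresentation. -/
theorem exists_monoidHom_of_eigenvector {ρ : Representation ℂ H W} {v : W} (hv : v ≠ 0)
    (h : ∀ g, ∃ c : ℂ, ρ g v = c • v) : ∃ χ : H →* ℂ, ∀ g, ρ g v = χ g • v := by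
  choose c hc using h
  refine ⟨⟨⟨c, ?_⟩, fun g k => ?_⟩, hc⟩
  · apply smul_left_injective ℂ hv
    simp only
    rw [← hc, map_one, Module.End.one_apply, one_smul]
  · apply smul_left_injective ℂ hv
    simp only
    rw [← hc, map_mul, Module.End.mul_apply, hc, map_smul, hc, smul_smul, mul_comm]

/-- The one-dimensional representation attached to a linear character. -/
def charRep (χ : H →* ℂ) : Representation ℂ H ℂ :=
  (Algebra.lmul ℂ ℂ).toRingHom.toMonoidHom.comp χ

theorem charRep_apply (χ : H →* ℂ) (g : H) (z : ℂ) : charRep χ g z = χ g * z := rfl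

theorem charRep_isIrreducible (χ : H →* ℂ) : (charRep χ).IsIrreducible where
  exists_pair_ne := ⟨⊥, ⊤, fun h => by
    have h1 : (1 : ℂ) ∈ (⊥ : Subrepresentation (charRep χ)) := by rw [h]; trivial
    exact one_ne_zero h1⟩
  eq_bot_or_eq_top S := by
    rcases eq_bot_or_eq_top S.toSubmodule with h | h
    · exact Or.inl (Subrepresentation.toSubmodule_injective h)
    · exact Or.inr (Subrepresentation.toSubmodule_injective h)

/-- The intertwining map from a linear character given by a common eigenvector. -/
def eigenvectorMap {ρ : Representation ℂ H W} (χ : H →* ℂ) (v : W) (h : ∀ g, ρ g v = χ g • v) :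
    Representation.IntertwiningMap (charRep χ) ρ where
  toLinearMap := LinearMap.toSpanSingleton ℂ W v
  isIntertwining' g := by
    ext
    simp [charRep_apply, h]

theorem eigenvectorMap_one {ρ : Representation ℂ H W} (χ : H →* ℂ) (v : W)
    (h : ∀ g, ρ g v = χ g • v) : eigenvectorMap χ v h 1 = v :=
  one_smul ℂ v

/-- In a multiplicity-free representation two common eigenvectors with the same eigenvalues are
proportional. -/
theorem eq_smul_of_finrank_le_one [FiniteDimensional ℂ W] {ρ : Representation ℂ H W}
    (hρ : ∀ χ : H →* ℂ, Module.finrank ℂ (Representation.IntertwiningMap (charRep χ) ρ) ≤ 1)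
    {v w : W} (hv : v ≠ 0) (h : ∀ g, ∃ c : ℂ, ρ g v = c • v ∧ ρ g w = c • w) :
    ∃ a : ℂ, w = a • v := by
  obtain ⟨χ, hχ⟩ := exists_monoidHom_of_eigenvector hv fun g => (h g).imp fun _ hc => hc.1
  have hχ' : ∀ g, ρ g w = χ g • w := by
    intro g
    obtain ⟨c, hc, hc'⟩ := h g
    rw [hc', smul_left_injective ℂ hv (hc.symm.trans (hχ g))]
  -- Both eigenvectors are images of `1` under intertwining maps from the same character, and these
  -- maps are multiples of a single `u`.
  obtain ⟨u, hu⟩ := finrank_le_one_iff.1 (hρ χ)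
  obtain ⟨a, ha⟩ := hu (eigenvectorMap χ v hχ)
  obtain ⟨b, hb⟩ := hu (eigenvectorMap χ w hχ')
  have ha' : a • u 1 = v := by
    rw [← eigenvectorMap_one χ v hχ, ← ha]; rfl
  have hb' : b • u 1 = w := by
    rw [← eigenvectorMap_one χ w hχ', ← hb]; rfl
  have ha0 : a ≠ 0 := by
    rintro rfl
    exact hv (by rw [← ha', zero_smul])
  exact ⟨b * a⁻¹, by rw [← ha', smul_smul, inv_mul_cancel_right₀ ha0, hb']⟩

/-- A representation of a commutative group is multiplicity-free if common eigenvectors with the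
same eigenvalues are proportional. -/
theorem finrank_le_one_of_eigenvectors [IsMulCommutative H] [FiniteDimensional ℂ W]
    {ρ : Representation ℂ H W}
    (hρ : ∀ (χ : H → ℂ) (v w : W), v ≠ 0 → (∀ g, ρ g v = χ g • v) → (∀ g, ρ g w = χ g • w) →
      ∃ a : ℂ, w = a • v)
    (σ : Representation ℂ H V) (hσ : σ.IsIrreducible) :
    Module.finrank ℂ (Representation.IntertwiningMap σ ρ) ≤ 1 := by
  rcases subsingleton_or_nontrivial (Representation.IntertwiningMap σ ρ) with hs | hs
  · rw [Module.finrank_zero_of_subsingleton]; exact zero_le_one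
  obtain ⟨f, hf⟩ := exists_ne (0 : Representation.IntertwiningMap σ ρ)
  -- A nonzero map out of an irreducible representation is injective. This makes `V`
  -- finite-dimensional, and commutativity then makes it a line, so an intertwining map is
  -- determined by the image of one vector.
  have hinj := (Representation.IsIrreducible.injective_or_eq_zero f).resolve_right hf
  have : FiniteDimensional ℂ V := FiniteDimensional.of_injective f.toLinearMap hinj
  have h1 := Representation.IsIrreducible.finrank_eq_one_of_isMulCommutative σ
  obtain ⟨v, hv, hspan⟩ := finrank_eq_one_iff'.1 h1
  choose χ hχ using fun g => hspan (σ g v)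
  have heig : ∀ (k : Representation.IntertwiningMap σ ρ) (g : H), ρ g (k v) = χ g • k v := by
    intro k g
    rw [← k.isIntertwining, ← hχ, map_smul]
  refine finrank_le_one f fun k => ?_
  obtain ⟨a, ha⟩ := hρ χ (f v) (k v) (fun h => hv (hinj (h.trans (map_zero f).symm)))
    (heig f) (heig k)
  refine ⟨a, DFunLike.ext _ _ fun x => ?_⟩
  obtain ⟨c, rfl⟩ := hspan x
  rw [map_smul, map_smul, ha]; rfl

end Multiplicity

/-! ### Adjoining a central involution; counting linear characters -/

section CentralInvolution

variable {G : Type*} [Group G] {z : G}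

/-- For a central involution `z`, the union of `L` and `zL` is already closed under products and
inverses. -/
theorem mem_zpowers_sup_iff (hz : z * z = 1) (hc : ∀ g, z * g = g * z) (L : Subgroup G) (g : G) :
    g ∈ Subgroup.zpowers z ⊔ L ↔ g ∈ L ∨ z * g ∈ L := by
  constructor
  · let M : Subgroup G :=
      { carrier := {g | g ∈ L ∨ z * g ∈ L}
        one_mem' := Or.inl L.one_mem
        mul_mem' := by
          rintro a b (ha | ha) (hb | hb)
          · exact Or.inl (mul_mem ha hb)
          · refine Or.inr ?_
            rw [← mul_assoc, hc a, mul_assoc]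
            exact mul_mem ha hb
          · refine Or.inr ?_
            rw [← mul_assoc]
            exact mul_mem ha hb
          · refine Or.inl ?_
            have : a * b = (z * a) * (z * b) := by
              rw [hc a, mul_assoc, ← mul_assoc z, hz, one_mul]
            rw [this]
            exact mul_mem ha hb
        inv_mem' := by
          rintro a (ha | ha)
          · exact Or.inl (inv_mem ha)
          · refine Or.inr ?_
            have : z * a⁻¹ = (z * a)⁻¹ := by
              rw [_root_.mul_inv_rev, inv_eq_of_mul_eq_one_left hz, hc]
            rw [this]
            exact inv_mem ha }
    have hM : Subgroup.zpowers z ⊔ L ≤ M :=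
      sup_le (Subgroup.zpowers_le.2 (Or.inr (by rw [hz]; exact L.one_mem))) fun _ h => Or.inl h
    exact fun h => hM h
  · rintro (h | h)
    · exact Subgroup.mem_sup_right h
    · have : g = z * (z * g) := by rw [← mul_assoc, hz, one_mul]
      rw [this]
      exact mul_mem (Subgroup.mem_sup_left (Subgroup.mem_zpowers z)) (Subgroup.mem_sup_right h)

/-- When `z ∉ L`, the cosets `L` and `zL` are distinct, so `L` has index two in the join. -/
theorem card_zpowers_sup (hz : z * z = 1) (hc : ∀ g, z * g = g * z) {L : Subgroup G}
    (hL : z ∉ L) : Nat.card (Subgroup.zpowers z ⊔ L : Subgroup G) = 2 * Nat.card L := by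
  have h2 : L.relIndex (Subgroup.zpowers z ⊔ L) = 2 :=
    Subgroup.relIndex_eq_two_iff_exists_notMem_and'.2
      ⟨z, Subgroup.mem_sup_left (Subgroup.mem_zpowers z), hL, fun b hb =>
        ((mem_zpowers_sup_iff hz hc L b).1 hb).symm⟩
  rw [← (L.subgroupOf (Subgroup.zpowers z ⊔ L)).index_mul_card, ← Subgroup.relIndex, h2,
    Nat.card_congr (Subgroup.subgroupOfEquivOfLe le_sup_right).toEquiv]

theorem disjoint_zpowers (hz : z * z = 1) {L : Subgroup G} (hL : z ∉ L) :
    Disjoint (Subgroup.zpowers z) L := by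
  rw [Subgroup.disjoint_def]
  intro g hg hgL
  obtain ⟨k, rfl⟩ := Subgroup.mem_zpowers_iff.1 hg
  have hz2 : z ^ (2 : ℤ) = 1 := by rw [zpow_two, hz]
  rcases Int.even_or_odd' k with ⟨m, rfl | rfl⟩
  · rw [_root_.zpow_mul, hz2, _root_.one_zpow]
  · rw [_root_.zpow_add, _root_.zpow_mul, hz2, _root_.one_zpow, one_mul, zpow_one] at hgL
    exact absurd hgL hL

/-- The number of complex linear characters of a finite group is at most its order. -/
theorem card_monoidHom_le (M : Type*) [Monoid M] [Finite M] :
    Finite (M →* ℂ) ∧ Nat.card (M →* ℂ) ≤ Nat.card M := by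
  have := Fintype.ofFinite M
  -- Dedekind's independence of characters, inside the space of functions on `M`, whose dimension is
  -- `|M|`.
  have hli := linearIndependent_monoidHom M ℂ
  have hfin : Finite (M →* ℂ) := hli.finite
  have := Fintype.ofFinite (M →* ℂ)
  refine ⟨hfin, ?_⟩
  rw [Nat.card_eq_fintype_card, Nat.card_eq_fintype_card]
  simpa using hli.fintype_card_le_finrank

/-- A map to the linear characters of a finite monoid that determines its argument up to sign. -/
theorem card_le_two_mul_card_of_fibers {X M : Type*} [Finite X] [Neg X] [Monoid M] [Finite M]
    (χ : X → M →* ℂ) (h : ∀ s t, χ s = χ t → t = s ∨ t = -s) :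
    Nat.card X ≤ 2 * Nat.card M := by
  classical
  have := Fintype.ofFinite X
  obtain ⟨hfin, hle⟩ := card_monoidHom_le M
  have := Fintype.ofFinite (M →* ℂ)
  have h2 : (Finset.univ : Finset X).card ≤ 2 * (Finset.univ.image χ).card := by
    refine Finset.card_le_mul_card_image _ _ fun φ hφ => ?_
    obtain ⟨s, -, rfl⟩ := Finset.mem_image.1 hφ
    refine (Finset.card_le_card (t := {s, -s}) fun t ht => ?_).trans Finset.card_le_two
    simpa using h s t (Finset.mem_filter.1 ht).2.symm
  rw [Nat.card_eq_fintype_card] at hle ⊢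
  exact h2.trans (Nat.mul_le_mul_left 2 ((Finset.card_le_univ _).trans hle))

end CentralInvolution

variable {F : Type*} [Field F] {n : ℕ}

/-! ### Structure of `B` and of `G = ⟨-I⟩ × B` -/

section Group

theorem negI_mul_negI : negI F n * negI F n = 1 :=
  Subtype.ext (by simp [negI])

theorem negI_comm (g : symplecticGroup (Fin n) F) : negI F n * g = g * negI F n :=
  Subtype.ext (by simp [negI])

theorem negI_notMem_subgroupB (hq : ringChar F ≠ 2) (hn : 0 < n) : negI F n ∉ subgroupB F n := by
  rintro ⟨Q, hQ, h⟩
  have h2 : (2 : F) ≠ 0 := Ring.two_ne_zero hq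
  have h1 := congrFun (congrFun (congrArg Subtype.val h) (Sum.inl ⟨0, hn⟩)) (Sum.inl ⟨0, hn⟩)
  simp only [negI, gMat, Matrix.neg_apply, Matrix.one_apply_eq, Matrix.fromBlocks_apply₁₁] at h1
  exact h2 (by linear_combination -h1)

theorem mem_subgroupG_iff (g : symplecticGroup (Fin n) F) :
    g ∈ subgroupG F n ↔ g ∈ subgroupB F n ∨ negI F n * g ∈ subgroupB F n :=
  mem_zpowers_sup_iff negI_mul_negI negI_comm _ g

theorem commute_of_mem_subgroupB {g h : symplecticGroup (Fin n) F} (hg : g ∈ subgroupB F n)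
    (hh : h ∈ subgroupB F n) : Commute g h := by
  obtain ⟨Q, hQ, rfl⟩ := hg
  obtain ⟨R, hR, rfl⟩ := hh
  rw [Commute, SemiconjBy, gMat_mul, gMat_mul]
  congr 1
  exact add_comm Q R

theorem commute_of_mem_subgroupG {g h : symplecticGroup (Fin n) F} (hg : g ∈ subgroupG F n)
    (hh : h ∈ subgroupG F n) : Commute g h := by
  have hz : ∀ k, Commute (negI F n) k := negI_comm
  have key : ∀ k, k = negI F n * (negI F n * k) := fun k => by
    rw [← mul_assoc, negI_mul_negI, one_mul]
  have aux : ∀ a ∈ subgroupB F n, ∀ b ∈ subgroupG F n, Commute a b := by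
    intro a ha b hb
    rcases (mem_subgroupG_iff b).1 hb with hb | hb
    · exact commute_of_mem_subgroupB ha hb
    · rw [key b]
      exact (hz a).symm.mul_right (commute_of_mem_subgroupB ha hb)
  rcases (mem_subgroupG_iff g).1 hg with hg | hg
  · exact aux g hg h hh
  · rw [key g]
    exact (hz h).mul_left (aux _ hg h hh)

theorem gMat_pow (Q : Matrix (Fin n) (Fin n) F) (hQ : Q.IsSymm) (k : ℕ) :
    (gMat Q hQ ^ k).1 = Matrix.fromBlocks 1 0 (k • Q) 1 := by
  induction k with
  | zero => simp
  | succ k ih =>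
    rw [pow_succ, Submonoid.coe_mul, ih, gMat, Matrix.fromBlocks_multiply]
    simp [add_mul]

/-- Powers of `g_Q` multiply `Q` by integers, so `B` has exponent dividing `p`. -/
theorem pow_ringChar_of_mem_subgroupB {g : symplecticGroup (Fin n) F} (hg : g ∈ subgroupB F n) :
    g ^ ringChar F = 1 := by
  obtain ⟨Q, hQ, rfl⟩ := hg
  apply Subtype.ext
  have : ringChar F • Q = 0 := by
    ext i j
    simp
  rw [gMat_pow, this]
  simp

/-- An element of `G` outside `B` is `-g_Q`; its `p`-th power is `(-I)^p = -I`, since `p` is odd and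
`g_Q` is killed by `p`. -/
theorem negI_mem_of_not_le {H : Subgroup (symplecticGroup (Fin n) F)} [Finite F]
    (hq : ringChar F ≠ 2) (hH : H ≤ subgroupG F n) (hB : ¬ H ≤ subgroupB F n) : negI F n ∈ H := by
  obtain ⟨g, hg, hgB⟩ := SetLike.not_le_iff_exists.1 hB
  have h1 := pow_ringChar_of_mem_subgroupB (((mem_subgroupG_iff g).1 (hH hg)).resolve_left hgB)
  rw [Commute.mul_pow (negI_comm g)] at h1
  have hodd : Odd (ringChar F) := (CharP.char_is_prime F (ringChar F)).odd_of_ne_two hq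
  obtain ⟨m, hm⟩ := hodd
  have h2 : negI F n ^ ringChar F = negI F n := by
    rw [hm, pow_succ, pow_mul, pow_two, negI_mul_negI, one_pow, one_mul]
  rw [h2, mul_eq_one_iff_eq_inv] at h1
  rw [h1]
  exact inv_mem (pow_mem hg _)

theorem eq_zpowers_sup_inf {H : Subgroup (symplecticGroup (Fin n) F)} (hH : H ≤ subgroupG F n)
    (hz : negI F n ∈ H) : H = Subgroup.zpowers (negI F n) ⊔ (H ⊓ subgroupB F n) := by
  apply le_antisymm
  · intro g hg
    rw [mem_zpowers_sup_iff negI_mul_negI negI_comm]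
    rcases (mem_subgroupG_iff g).1 (hH hg) with h | h
    · exact Or.inl ⟨hg, h⟩
    · exact Or.inr ⟨mul_mem hz hg, h⟩
  · exact sup_le (Subgroup.zpowers_le.2 hz) inf_le_left

theorem eq_zero_of_neg_eq (hq : ringChar F ≠ 2) {t : Fin n → F} (h : -t = t) : t = 0 := by
  have h2 : (2 : F) ≠ 0 := Ring.two_ne_zero hq
  funext i
  have h3 : 2 * t i = 0 := by
    have := congrFun h i
    simp only [Pi.neg_apply] at this
    linear_combination -this
  simpa [h2] using h3

end Group

/-! ### The Weil operators on `G`, up to scalars -/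

section Operators

variable [Finite F]

/-- The quadratic exponential `ψ(-t Q tᵀ)`, where `Q` is the lower left block of `g`. -/
noncomputable def quadExp (t : Fin n → F) (g : symplecticGroup (Fin n) F) : ℂ :=
  canonicalChar F (-(t ⬝ᵥ (g.1.toBlocks₂₁ *ᵥ t)))

theorem quadExp_gMat (t : Fin n → F) (Q : Matrix (Fin n) (Fin n) F) (hQ : Q.IsSymm) :
    quadExp t (gMat Q hQ) = canonicalChar F (-(t ⬝ᵥ (Q *ᵥ t))) := by
  rw [quadExp, gMat, Matrix.toBlocks_fromBlocks₂₁]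

theorem quadExp_neg (t : Fin n → F) (g : symplecticGroup (Fin n) F) :
    quadExp (-t) g = quadExp t g := by
  simp [quadExp, Matrix.mulVec_neg]

variable (F n) in
/-- For `t ∈ Fⁿ`, the linear character `g_Q ↦ ψ(-t Q tᵀ)` of `B`. -/
noncomputable def quadChar (t : Fin n → F) : subgroupB F n →* ℂ where
  toFun g := quadExp t g.1
  map_one' := by
    rw [OneMemClass.coe_one, ← gMat_zero, quadExp_gMat]
    simp
  map_mul' := by
    rintro ⟨_, Q, hQ, rfl⟩ ⟨_, R, hR, rfl⟩
    change quadExp t (gMat Q hQ * gMat R hR) = quadExp t (gMat Q hQ) * quadExp t (gMat R hR)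
    rw [gMat_mul, quadExp_gMat, quadExp_gMat, quadExp_gMat, ← AddChar.map_add_eq_mul,
      Matrix.add_mulVec, dotProduct_add, neg_add]

theorem quadChar_apply (t : Fin n → F) (g : subgroupB F n) : quadChar F n t g = quadExp t g.1 :=
  rfl

/-- Multiplication by the quadratic exponential. -/
noncomputable def quadMul (g : symplecticGroup (Fin n) F) :
    Module.End ℂ ((Fin n → F) → ℂ) where
  toFun f t := quadExp t g * f t
  map_add' f k := by ext t; simp [mul_add]
  map_smul' c f := by ext t; simp; ring

theorem quadMul_apply (g : symplecticGroup (Fin n) F) (f : (Fin n → F) → ℂ) (t : Fin n → F) :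
    quadMul g f t = quadExp t g * f t := rfl

/-- Since `g_Q` sends `(x, y)` to `(x + yQ, y)`, the phases match by expanding `(t + y) Q (t + y)ᵀ`
for symmetric `Q`. -/
theorem quadMul_intertwines {g : symplecticGroup (Fin n) F} (hg : g ∈ subgroupB F n)
    (v : Fin n ⊕ Fin n → F) : weylOp v * quadMul g = quadMul g * weylOp (v ᵥ* g.1) := by
  obtain ⟨Q, hQ, rfl⟩ := hg
  ext1 f
  funext t
  obtain ⟨x, y, rfl⟩ : ∃ x y : Fin n → F, v = Sum.elim x y :=
    ⟨v ∘ Sum.inl, v ∘ Sum.inr, (Sum.elim_comp_inl_inr v).symm⟩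
  have e : Sum.elim x y ᵥ* (gMat Q hQ).1 = Sum.elim (x + y ᵥ* Q) y := by
    rw [gMat, Matrix.vecMul_fromBlocks]
    simp
  simp only [e, Module.End.mul_apply, weylOp_apply, quadMul_apply, Sum.elim_comp_inl,
    Sum.elim_comp_inr, quadExp_gMat, ← mul_assoc, ← AddChar.map_add_eq_mul]
  congr 2
  have h1 : y ᵥ* Q = Q *ᵥ y := by rw [← Matrix.mulVec_transpose, hQ.eq]
  have h2 : y ⬝ᵥ (Q *ᵥ t) = t ⬝ᵥ (Q *ᵥ y) := by
    rw [Matrix.dotProduct_mulVec, h1, dotProduct_comm]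
  simp only [h1, Matrix.mulVec_add, dotProduct_add, add_dotProduct, h2]
  rw [dotProduct_comm (Q *ᵥ y) y]
  ring

/-- Schur's lemma: any nonzero intertwiner serves in place of `W(g)`, so the determinant
normalization need not be computed. -/
theorem exists_ne_zero_weilRep_eq_smul (hq : ringChar F ≠ 2) (g : symplecticGroup (Fin n) F)
    {T : Module.End ℂ ((Fin n → F) → ℂ)} (hT : T ≠ 0)
    (h : ∀ v, weylOp v * T = T * weylOp (v ᵥ* g.1)) :
    ∃ c : ℂ, c ≠ 0 ∧ weilRep hq n g = c • T := by
  have hW := isWeilOperator_weilRep (n := n) hq g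
  obtain ⟨c, hc⟩ := scalar_of_intertwines hq g (isUnit_of_intertwines hq g T hT h) h
    hW.intertwines
  refine ⟨c, ?_, hc⟩
  rintro rfl
  rw [zero_smul] at hc
  exact hW.isUnit.ne_zero hc

theorem weilRep_of_mem_subgroupB (hq : ringChar F ≠ 2) {g : symplecticGroup (Fin n) F}
    (hg : g ∈ subgroupB F n) : ∃ c : ℂ, c ≠ 0 ∧ weilRep hq n g = c • quadMul g := by
  refine exists_ne_zero_weilRep_eq_smul hq g (fun h => ?_) (quadMul_intertwines hg)
  -- The operator is nonzero because it sends the constant function `1` to a function with value `1`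
  -- at the origin.
  have h1 := congrFun (LinearMap.congr_fun h (fun _ => 1)) 0
  simp [quadMul_apply, quadExp] at h1

theorem weilRep_negI (hq : ringChar F ≠ 2) :
    ∃ c : ℂ, c ≠ 0 ∧ weilRep hq n (negI F n) = c • parity := by
  refine exists_ne_zero_weilRep_eq_smul hq _ (fun h => ?_) fun v => ?_
  · have h1 := congrFun (LinearMap.congr_fun h (fun _ => 1)) 0
    simp [parity, LinearMap.funLeft_apply] at h1
  · have h1 := parity_weylOp (-v)
    rw [neg_neg] at h1
    rw [← h1, negI, Matrix.vecMul_neg, Matrix.vecMul_one]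

omit [Finite F] in
theorem parity_apply (f : (Fin n → F) → ℂ) (t : Fin n → F) : parity f t = f (-t) := rfl

end Operators

/-! ### The lower bound for Weil-free subgroups -/

section Bound

variable [Finite F] {H : Subgroup (symplecticGroup (Fin n) F)}

/-- Only one-dimensional `σ` are needed here: two independent vectors with the same eigenvalues
would give a linear character multiplicity at least 2. -/
theorem WeilFree.eq_smul {hq : ringChar F ≠ 2} (hW : WeilFree hq H)
    {v w : (Fin n → F) → ℂ} (hv : v ≠ 0)
    (h : ∀ g ∈ H, ∃ c : ℂ, weilRep hq n g v = c • v ∧ weilRep hq n g w = c • w) :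
    ∃ a : ℂ, w = a • v :=
  eq_smul_of_finrank_le_one (ρ := (weilRep hq n).comp H.subtype)
    (fun χ => hW ℂ (charRep χ) (charRep_isIrreducible χ)) hv fun g => h g.1 g.2

theorem quadMul_single [DecidableEq (Fin n → F)] (g : symplecticGroup (Fin n) F)
    (t : Fin n → F) : quadMul g (Pi.single t 1) = quadExp t g • Pi.single t (1 : ℂ) := by
  funext r
  rw [quadMul_apply]
  by_cases hr : r = t
  · subst hr; simp
  · simp [hr]

/-- A Weil-free subgroup of `G` contains `-I`. -/
theorem WeilFree.negI_mem {hq : ringChar F ≠ 2} (hn : 0 < n) (hW : WeilFree hq H)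
    (hH : H ≤ subgroupG F n) : negI F n ∈ H := by
  classical
  refine negI_mem_of_not_le hq hH fun hB => ?_
  -- Any nonzero `t` would do; its existence is where `n ≥ 1` enters. The delta functions at `t` and
  -- `-t` have equal eigenvalues under every `g_Q`.
  let t : Fin n → F := fun _ => 1
  have ht : t ≠ 0 := fun h => one_ne_zero (congrFun h ⟨0, hn⟩)
  have hne : -t ≠ t := fun h => ht (eq_zero_of_neg_eq hq h)
  obtain ⟨a, ha⟩ := hW.eq_smul (v := Pi.single t 1) (w := Pi.single (-t) 1)
    (by simp) fun g hg => by
      obtain ⟨c, -, hc⟩ := weilRep_of_mem_subgroupB hq (hB hg)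
      refine ⟨c * quadExp t g, ?_, ?_⟩
      · rw [hc, LinearMap.smul_apply, quadMul_single, smul_smul]
      · rw [hc, LinearMap.smul_apply, quadMul_single, quadExp_neg, smul_smul]
  have := congrFun ha (-t)
  simp [hne] at this

/-- For a Weil-free subgroup `H` of `G`, the character `g_Q ↦ ψ(-t Q tᵀ)` on `H ∩ B` determines
`t` up to sign. -/
theorem WeilFree.eq_or_eq_neg {hq : ringChar F ≠ 2} (hW : WeilFree hq H)
    (hH : H ≤ subgroupG F n) {s t : Fin n → F}
    (h : ∀ g ∈ H ⊓ subgroupB F n, quadExp s g = quadExp t g) (hz : negI F n ∈ H) :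
    t = s ∨ t = -s := by
  classical
  by_contra! hne
  obtain ⟨hne1, hne2⟩ := hne
  -- The even vectors `δ_r + δ_{-r}`. At `r = 0` this is `2 δ_0`, still nonzero, so the origin needs
  -- no separate argument.
  let e : (Fin n → F) → (Fin n → F) → ℂ := fun r => Pi.single r 1 + Pi.single (-r) 1
  have he : ∀ r, e r r ≠ 0 := by
    intro r
    by_cases hr : r = -r
    · simp [e, ← hr]
    · simp [e, hr]
  have hB : ∀ g ∈ subgroupB F n, ∀ r, quadMul g (e r) = quadExp r g • e r := by
    intro g _ r
    simp only [e, map_add, quadMul_single, quadExp_neg, smul_add]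
  have hP : ∀ r, parity (e r) = e r := by
    intro r
    funext u
    simp [parity_apply, e, Pi.single_apply, neg_eq_iff_eq_neg, add_comm]
  obtain ⟨d, -, hd⟩ := weilRep_negI (n := n) hq
  have hPe : ∀ r, weilRep hq n (negI F n) (e r) = d • e r := fun r => by
    rw [hd, LinearMap.smul_apply, hP]
  obtain ⟨a, ha⟩ := hW.eq_smul (v := e s) (w := e t) (fun h0 => he s (congrFun h0 s))
    fun g hg => by
      have key : ∀ k ∈ H ⊓ subgroupB F n,
          ∃ c : ℂ, weilRep hq n k (e s) = c • e s ∧ weilRep hq n k (e t) = c • e t := by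
        intro k hk
        obtain ⟨c, -, hc⟩ := weilRep_of_mem_subgroupB hq hk.2
        refine ⟨c * quadExp s k, ?_, ?_⟩
        · rw [hc, LinearMap.smul_apply, hB k hk.2, smul_smul]
        · rw [hc, LinearMap.smul_apply, hB k hk.2, smul_smul, h k hk]
      -- Outside `B`, write `g` as `-I` times an element of `H ∩ B`; since both vectors are even,
      -- `-I` acts on them by the same scalar `d`.
      rcases (mem_subgroupG_iff g).1 (hH hg) with hgB | hgB
      · exact key g ⟨hg, hgB⟩
      · obtain ⟨c, h1, h2⟩ := key (negI F n * g) ⟨mul_mem hz hg, hgB⟩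
        have hg' : weilRep hq n g
            = weilRep hq n (negI F n) * weilRep hq n (negI F n * g) := by
          rw [← map_mul, ← mul_assoc, negI_mul_negI, one_mul]
        refine ⟨c * d, ?_, ?_⟩
        · rw [hg', Module.End.mul_apply, h1, map_smul, hPe, smul_smul]
        · rw [hg', Module.End.mul_apply, h2, map_smul, hPe, smul_smul]
  have h1 := congrFun ha t
  have h2 : e s t = 0 := by simp [e, hne1, hne2]
  rw [Pi.smul_apply, h2, smul_zero] at h1
  exact he t h1

/-- For a Weil-free subgroup `H` of `G`, the fibres of `t ↦ (g_Q ↦ ψ(-t Q tᵀ))` on `H ∩ B` have at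
most two elements. -/
theorem WeilFree.card_pow_le {hq : ringChar F ≠ 2} (hW : WeilFree hq H)
    (hH : H ≤ subgroupG F n) (hz : negI F n ∈ H) :
    Nat.card F ^ n ≤ 2 * Nat.card (H ⊓ subgroupB F n : Subgroup (symplecticGroup (Fin n) F)) := by
  have h := card_le_two_mul_card_of_fibers
    (fun t : Fin n → F => (quadChar F n t).comp
      (Subgroup.inclusion (inf_le_right : H ⊓ subgroupB F n ≤ subgroupB F n)))
    fun s t hst => hW.eq_or_eq_neg hH (fun g hg => by
      have h1 := DFunLike.congr_fun hst
        (⟨g, hg⟩ : (H ⊓ subgroupB F n : Subgroup (symplecticGroup (Fin n) F)))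
      rwa [MonoidHom.comp_apply, MonoidHom.comp_apply, quadChar_apply, quadChar_apply] at h1) hz
  rwa [Nat.card_fun, Nat.card_fin] at h

/-- As `2 < p`, the hypothesis gives `p^a < p^(b+1)`, so `a ≤ b`: distinct powers of `p` differ by a
factor exceeding 2. -/
theorem pow_le_of_pow_le_two_mul {p a b : ℕ} (hp : 2 < p) (h : p ^ a ≤ 2 * p ^ b) :
    p ^ a ≤ p ^ b := by
  have hlt : p ^ a < p ^ (b + 1) := by
    refine h.trans_lt ?_
    rw [pow_succ, mul_comm]
    exact Nat.mul_lt_mul_of_pos_left hp (pow_pos (by omega) b)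
  exact Nat.pow_le_pow_right (by omega)
    (Nat.lt_succ_iff.1 ((Nat.pow_lt_pow_iff_right (by omega)).1 hlt))

theorem exists_card_eq_ringChar_pow {L : Subgroup (symplecticGroup (Fin n) F)}
    (hL : L ≤ subgroupB F n) : ∃ k, Nat.card L = ringChar F ^ k := by
  have : Fact (ringChar F).Prime := ⟨CharP.char_is_prime F _⟩
  have hpg : IsPGroup (ringChar F) L := fun g =>
    ⟨1, Subtype.ext (by rw [pow_one]; exact pow_ringChar_of_mem_subgroupB (hL g.2))⟩
  exact IsPGroup.iff_card.1 hpg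

/-- Counting characters gives only `q^n ≤ 2 |H ∩ B|`; the lost factor 2 is recovered because both
sides involve powers of the same odd prime. -/
theorem WeilFree.card_le {hq : ringChar F ≠ 2} (hn : 0 < n) (hW : WeilFree hq H)
    (hH : H ≤ subgroupG F n) : 2 * Nat.card F ^ n ≤ Nat.card H := by
  have := Fintype.ofFinite F
  have hz := hW.negI_mem hn hH
  rw [eq_zpowers_sup_inf hH hz, card_zpowers_sup negI_mul_negI negI_comm
    fun h => negI_notMem_subgroupB hq hn (Subgroup.mem_inf.1 h).2]
  apply Nat.mul_le_mul_left
  have h1 := hW.card_pow_le hH hz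
  obtain ⟨k, hk⟩ := exists_card_eq_ringChar_pow (inf_le_right : H ⊓ subgroupB F n ≤ _)
  obtain ⟨m, hp, hm⟩ := FiniteField.card F (ringChar F)
  rw [Nat.card_eq_fintype_card, hm, ← pow_mul, hk] at h1 ⊢
  exact pow_le_of_pow_le_two_mul (lt_of_le_of_ne hp.two_le hq.symm) h1

end Bound

/-! ### The subgroup of trace forms -/

section TraceForm

variable {K : Type*} [Field K] [Algebra F K]

/-- The subgroup `{g_{Q_α} : α ∈ K}` of `B`. -/
noncomputable def traceSubgroup (b : Module.Basis (Fin n) F K) :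
    Subgroup (symplecticGroup (Fin n) F) where
  carrier := Set.range fun α : K => gMat (traceMatrix b α) (traceMatrix_isSymm b α)
  one_mem' := ⟨0, by
    have h : traceMatrix b 0 = 0 := by
      ext i j
      simp [traceMatrix]
    rw [← gMat_zero]
    simp only [h]⟩
  mul_mem' := by
    rintro _ _ ⟨α, rfl⟩ ⟨β, rfl⟩
    refine ⟨α + β, ?_⟩
    dsimp only
    rw [gMat_mul]
    congr 1
    ext i j
    simp [traceMatrix, add_mul]
  inv_mem' := by
    rintro _ ⟨α, rfl⟩
    refine ⟨-α, (inv_eq_of_mul_eq_one_right ?_).symm⟩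
    rw [gMat_mul, ← gMat_zero]
    congr 1
    ext i j
    simp [traceMatrix]

theorem traceSubgroup_le (b : Module.Basis (Fin n) F K) : traceSubgroup b ≤ subgroupB F n := by
  rintro _ ⟨α, rfl⟩
  exact ⟨_, _, rfl⟩

variable [Finite F]

/-- An extension of finite degree of a finite field is separable, so its trace form is
nondegenerate. -/
theorem eq_zero_of_trace_mul (b : Module.Basis (Fin n) F K) {δ : K}
    (h : ∀ α, Algebra.trace F K (δ * α) = 0) : δ = 0 := by
  have : FiniteDimensional F K := b.finiteDimensional_of_finite
  exact (traceForm_nondegenerate F K).1 δ h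

/-- The matrix determines the bilinear form `tr(α ξ η)` on all of `K`; setting `ξ = 1` reduces to
nondegeneracy of the trace form. -/
theorem traceMatrix_injective (b : Module.Basis (Fin n) F K) :
    Function.Injective (traceMatrix b) := by
  intro α β h
  refine sub_eq_zero.1 (eq_zero_of_trace_mul b fun γ => ?_)
  have key : ∀ i, LinearMap.comp (Algebra.trace F K) (LinearMap.mulLeft F ((α - β) * b i)) = 0 :=
    fun i => b.ext fun j => by
      have := congrFun (congrFun h i) j
      simp only [traceMatrix, Matrix.of_apply] at this
      simp [sub_mul, this]
  have h1 : ∀ ξ η, Algebra.trace F K ((α - β) * ξ * η) = 0 := by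
    intro ξ η
    have : LinearMap.comp (Algebra.trace F K) (LinearMap.mulLeft F ((α - β) * η)) = 0 :=
      b.ext fun i => by
        have := LinearMap.congr_fun (key i) η
        simp only [LinearMap.comp_apply, LinearMap.mulLeft_apply, LinearMap.zero_apply] at this ⊢
        rw [mul_right_comm, this]
    have := LinearMap.congr_fun this ξ
    simp only [LinearMap.comp_apply, LinearMap.mulLeft_apply, LinearMap.zero_apply] at this
    rw [mul_right_comm, this]
  simpa using h1 1 γ

theorem card_traceSubgroup (b : Module.Basis (Fin n) F K) :
    Nat.card (traceSubgroup b) = Nat.card F ^ n := by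
  have hinj : Function.Injective fun α : K => gMat (traceMatrix b α) (traceMatrix_isSymm b α) := by
    intro α β h
    apply traceMatrix_injective b
    have h1 := congrArg (fun g => g.1.toBlocks₂₁) h
    simpa only [gMat, Matrix.toBlocks_fromBlocks₂₁] using h1
  have h1 : Nat.card (traceSubgroup b) = Nat.card K :=
    Nat.card_congr (Equiv.ofInjective _ hinj).symm
  rw [h1, Nat.card_congr b.equivFun.toEquiv, Nat.card_fun, Nat.card_fin]

/-- The characters `g_{Q_α} ↦ ψ(-t Q_α tᵀ)` determine `t` up to sign. -/
theorem eq_or_eq_neg_of_quadExp_eq (b : Module.Basis (Fin n) F K) {s t : Fin n → F}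
    (h : ∀ α, quadExp s (gMat (traceMatrix b α) (traceMatrix_isSymm b α))
      = quadExp t (gMat (traceMatrix b α) (traceMatrix_isSymm b α))) : s = t ∨ s = -t := by
  have hquad : ∀ (r : Fin n → F) (α : K), r ⬝ᵥ (traceMatrix b α *ᵥ r)
      = Algebra.trace F K (α * (b.equivFun.symm r) ^ 2) := by
    intro r α
    rw [← traceMatrix_quadratic b, ← b.equivFun_apply, LinearEquiv.apply_symm_apply]
  have h1 : (b.equivFun.symm t) ^ 2 - (b.equivFun.symm s) ^ 2 = 0 := by
    refine eq_zero_of_trace_mul b fun α => eq_zero_of_canonicalChar fun c => ?_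
    -- Scaling `α` by every `c` in `F` upgrades equality of values of `ψ` to equality of the traces
    -- themselves.
    have h2 := h (c • α)
    rw [quadExp_gMat, quadExp_gMat, hquad, hquad] at h2
    have e : Algebra.trace F K
        (((b.equivFun.symm t) ^ 2 - (b.equivFun.symm s) ^ 2) * α) * c
        = -Algebra.trace F K (c • α * (b.equivFun.symm s) ^ 2)
          - -Algebra.trace F K (c • α * (b.equivFun.symm t) ^ 2) := by
      rw [mul_comm _ α, mul_sub, map_sub, smul_mul_assoc, smul_mul_assoc, map_smul, map_smul,
        smul_eq_mul, smul_eq_mul]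
      ring
    rw [e, AddChar.map_sub_eq_div, h2, div_self (AddChar.val_isUnit _ _).ne_zero]
  rcases sq_eq_sq_iff_eq_or_eq_neg.1 (sub_eq_zero.1 h1) with h2 | h2
  · exact Or.inl (b.equivFun.symm.injective h2).symm
  · rw [← map_neg] at h2
    exact Or.inr (neg_eq_iff_eq_neg.1 (b.equivFun.symm.injective h2).symm)

/-- The characters of the trace subgroup confine a common eigenvector to one pair `{t, -t}`, and the
eigenvalue of `-I` ties its two values together. -/
theorem weilFree_zpowers_sup_traceSubgroup (hq : ringChar F ≠ 2) (b : Module.Basis (Fin n) F K) :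
    WeilFree hq (Subgroup.zpowers (negI F n) ⊔ traceSubgroup b) := by
  have hle : Subgroup.zpowers (negI F n) ⊔ traceSubgroup b ≤ subgroupG F n :=
    sup_le_sup_left (traceSubgroup_le b) _
  intro V _ _ σ hσ
  have : IsMulCommutative (Subgroup.zpowers (negI F n) ⊔ traceSubgroup b :
      Subgroup (symplecticGroup (Fin n) F)) :=
    ⟨⟨fun g h => Subtype.ext (commute_of_mem_subgroupG (hle g.2) (hle h.2))⟩⟩
  refine finrank_le_one_of_eigenvectors (fun χ v w hv hχv hχw => ?_) σ hσ
  obtain ⟨t, ht⟩ := Function.ne_iff.1 hv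
  obtain ⟨d, hd0, hd⟩ := weilRep_negI (n := n) hq
  have hz : negI F n ∈ Subgroup.zpowers (negI F n) ⊔ traceSubgroup b :=
    Subgroup.mem_sup_left (Subgroup.mem_zpowers _)
  have hpar : ∀ u, (∀ g, (weilRep hq n).comp (Subgroup.subtype _) g u = χ g • u) →
      ∀ r, u (-r) = d⁻¹ * χ ⟨negI F n, hz⟩ * u r := by
    intro u hu r
    have h1 := congrFun (hu ⟨negI F n, hz⟩) r
    change weilRep hq n (negI F n) u r = _ at h1
    rw [hd] at h1
    simp only [LinearMap.smul_apply, Pi.smul_apply, parity_apply, smul_eq_mul] at h1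
    rw [mul_assoc, ← h1, inv_mul_cancel_left₀ hd0]
  -- The value `a` is the eigenvalue of `g_{Q_α}` divided by the scalar in `W(g_{Q_α})`. It depends
  -- neither on the eigenvector nor on the point of its support, so the supports of `v` and `w` can
  -- be compared.
  have hval : ∀ α, ∃ a : ℂ, ∀ u,
      (∀ g, (weilRep hq n).comp (Subgroup.subtype _) g u = χ g • u) → ∀ r, u r ≠ 0 →
      quadExp r (gMat (traceMatrix b α) (traceMatrix_isSymm b α)) = a := by
    intro α
    have hg : gMat (traceMatrix b α) (traceMatrix_isSymm b α) ∈ traceSubgroup b := ⟨α, rfl⟩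
    obtain ⟨c, hc0, hc⟩ := weilRep_of_mem_subgroupB hq (traceSubgroup_le b hg)
    refine ⟨c⁻¹ * χ ⟨_, Subgroup.mem_sup_right hg⟩, fun u hu r hr => ?_⟩
    have h1 := congrFun (hu ⟨_, Subgroup.mem_sup_right hg⟩) r
    change weilRep hq n (gMat (traceMatrix b α) (traceMatrix_isSymm b α)) u r = _ at h1
    rw [hc] at h1
    simp only [LinearMap.smul_apply, Pi.smul_apply, quadMul_apply, smul_eq_mul] at h1
    rw [← mul_assoc] at h1
    rw [← mul_right_cancel₀ hr h1, inv_mul_cancel_left₀ hc0]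
  have hsupp : ∀ u, (∀ g, (weilRep hq n).comp (Subgroup.subtype _) g u = χ g • u) →
      ∀ r, u r ≠ 0 → r = t ∨ r = -t := by
    intro u hu r hr
    refine eq_or_eq_neg_of_quadExp_eq b fun α => ?_
    obtain ⟨a, ha⟩ := hval α
    rw [ha u hu r hr, ha v hχv t ht]
  refine ⟨w t * (v t)⁻¹, funext fun r => ?_⟩
  rw [Pi.smul_apply, smul_eq_mul]
  have ht' : v t ≠ 0 := ht
  by_cases hr : r = t
  · rw [hr, inv_mul_cancel_right₀ ht']
  by_cases hr' : r = -t
  · rw [hr', hpar v hχv, hpar w hχw]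
    field_simp
  · have h0 : ∀ u, (∀ g, (weilRep hq n).comp (Subgroup.subtype _) g u = χ g • u) → u r = 0 :=
      fun u hu => by_contra fun h => (hsupp u hu r h).elim hr hr'
    rw [h0 v hχv, h0 w hχw, mul_zero]

theorem card_zpowers_sup_traceSubgroup (hq : ringChar F ≠ 2) (hn : 0 < n)
    (b : Module.Basis (Fin n) F K) :
    Nat.card (Subgroup.zpowers (negI F n) ⊔ traceSubgroup b :
      Subgroup (symplecticGroup (Fin n) F)) = 2 * Nat.card F ^ n := by
  rw [card_zpowers_sup negI_mul_negI negI_comm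
    fun h => negI_notMem_subgroupB hq hn (traceSubgroup_le b h), card_traceSubgroup]

/-- Supplies a degree `n` extension, so that the trace subgroup exists and the bound is attained. -/
theorem nonempty_basis_extension (F : Type*) [Field F] [Finite F] (n : ℕ) (hn : 0 < n) :
    ∃ (K : Type) (_ : Field K) (_ : Algebra F K), Nonempty (Module.Basis (Fin n) F K) := by
  have : Fact (ringChar F).Prime := ⟨CharP.char_is_prime F _⟩
  have : NeZero n := ⟨hn.ne'⟩
  exact ⟨FiniteField.Extension F (ringChar F) n, inferInstance, inferInstance,
    ⟨Module.finBasisOfFinrankEq _ _ (FiniteField.finrank_extension F (ringChar F) n)⟩⟩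

end TraceForm

end SymplecticWeil

theorem mainTheorem5 {F : Type*} [Field F] [Finite F] (hq : ringChar F ≠ 2) (n : ℕ) (hn : 0 < n) :
    IsLeast {m : ℕ | ∃ H : Subgroup (Matrix.symplecticGroup (Fin n) F),
        H ≤ SymplecticWeil.subgroupG F n ∧ SymplecticWeil.WeilFree hq H ∧ m = Nat.card H}
      (2 * Nat.card F ^ n) ∧
    ∀ (K : Type*) [Field K] [Algebra F K] (b : Module.Basis (Fin n) F K),
      ∃ L H : Subgroup (Matrix.symplecticGroup (Fin n) F),
        (L : Set (Matrix.symplecticGroup (Fin n) F)) = Set.range (fun α : K =>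
          SymplecticWeil.gMat (SymplecticWeil.traceMatrix b α)
            (SymplecticWeil.traceMatrix_isSymm b α)) ∧
        Disjoint (Subgroup.zpowers (SymplecticWeil.negI F n)) L ∧
        H = Subgroup.zpowers (SymplecticWeil.negI F n) ⊔ L ∧
        H ≤ SymplecticWeil.subgroupG F n ∧
        Nat.card H = 2 * Nat.card F ^ n ∧
        SymplecticWeil.WeilFree hq H := by
  refine ⟨⟨?_, ?_⟩, ?_⟩
  · obtain ⟨K, _, _, ⟨b⟩⟩ := SymplecticWeil.nonempty_basis_extension F n hn
    exact ⟨Subgroup.zpowers (SymplecticWeil.negI F n) ⊔ SymplecticWeil.traceSubgroup b,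
      sup_le_sup_left (SymplecticWeil.traceSubgroup_le b) _,
      SymplecticWeil.weilFree_zpowers_sup_traceSubgroup hq b,
      (SymplecticWeil.card_zpowers_sup_traceSubgroup hq hn b).symm⟩
  · rintro _ ⟨H, hH, hW, rfl⟩
    exact hW.card_le hn hH
  · intro K _ _ b
    exact ⟨SymplecticWeil.traceSubgroup b, _, rfl,
      SymplecticWeil.disjoint_zpowers SymplecticWeil.negI_mul_negI
        fun h => SymplecticWeil.negI_notMem_subgroupB hq hn (SymplecticWeil.traceSubgroup_le b h),
      rfl, sup_le_sup_left (SymplecticWeil.traceSubgroup_le b) _,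
      SymplecticWeil.card_zpowers_sup_traceSubgroup hq hn b,
      SymplecticWeil.weilFree_zpowers_sup_traceSubgroup hq b⟩
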